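/- The cop number $c(G)$ of a finite connected graph $G$ is the least $k\ge 1$ such that $k$ cops have a winning strategy in the following game. The cops first choose their starting vertices (several cops may share a vertex), then the robber, seeing them, chooses his. Afterwards they alternate, the cops moving first; in each turn of the cops every cop stays or moves to a neighbouring vertex, and in each turn of the robber he does the same. All positions are visible to both sides. The cops win if at some time a cop is at the same vertex as the robber. All logarithms are binary. Theorem 1.1. Every connected graph on $n$ vertices has cop number at most $n\,2^{-(1+o(1))\sqrt{\log n}}$; that is, there is a function $\varepsilon:\mathbb{N}\to\mathbb{R}$ with $\varepsilon(n)\to 0$ as $n\to\infty$ such that $c(G)\le n\,2^{-(1+\varepsilon(n))\sqrt{\log n}}$ for every $n \ge 1$ and every connected graph $G$ on $n$ vertices. Concretely, $c(G)\le 2n(\log n)^3\,2^{-\sqrt{\log n}}$ for every $n\ge 2$ and every connected graph $G$ on $n$ vertices. -/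

import Mathlib

open Filter Topology

namespace SimpleGraph

variable {V : Type*}

/-- A (history-dependent) strategy for `k` cops on `G`. A history is the list of the vertices that
the robber has occupied so far, the most recent one first; the cops see all of it.
`pos []` is the initial placement of the cops, chosen before the robber appears, and `pos (v :: h)`
is their placement after they have answered to the robber's arrival at `v`. Several cops may share
a vertex, and in one turn each cop stays or moves to a neighbour. -/
structure CopStrategy (G : SimpleGraph V) (k : ℕ) where
  pos : List V → Fin k → V
  legal : ∀ (h : List V) (v : V) (i : Fin k),
    pos (v :: h) i = pos h i ∨ G.Adj (pos h i) (pos (v :: h) i)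

/-- A legal sequence of robber positions: `r 0` is his starting vertex, which is arbitrary, and in
every later turn he stays or moves to a neighbour. -/
def IsRobberRoute (G : SimpleGraph V) (r : ℕ → V) : Prop :=
  ∀ t, r (t + 1) = r t ∨ G.Adj (r t) (r (t + 1))

/-- The first `t` positions `r (t - 1), …, r 0` of the robber, the most recent one first. -/
def robberHistory (r : ℕ → V) : ℕ → List V
  | 0 => []
  | t + 1 => r t :: robberHistory r t

/-- A cop strategy is winning if against every legal robber there is a time at which a cop and the
robber are at the same vertex: just after the robber has arrived at `r t` (the first alternative),
or just after the cops' next move (the second one). -/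
def CopStrategy.IsWinning {G : SimpleGraph V} {k : ℕ} (S : G.CopStrategy k) : Prop :=
  ∀ r : ℕ → V, G.IsRobberRoute r → ∃ (t : ℕ) (i : Fin k),
    S.pos (robberHistory r t) i = r t ∨ S.pos (robberHistory r (t + 1)) i = r t

/-- `k ≥ 1` cops have a winning strategy on `G`. -/
def CopsWin (G : SimpleGraph V) (k : ℕ) : Prop :=
  1 ≤ k ∧ ∃ S : G.CopStrategy k, S.IsWinning

/-- The cop number: the least number of cops that have a winning strategy. For a finite nonempty
graph the minimum is attained, see `copsWin_copNumber`. -/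
noncomputable def copNumber (G : SimpleGraph V) : ℕ :=
  sInf {k : ℕ | G.CopsWin k}

/-- On a finite nonempty graph, one cop on each vertex wins. -/
theorem copsWin_card [Fintype V] [Nonempty V] (G : SimpleGraph V) :
    G.CopsWin (Fintype.card V) := by
  refine ⟨Fintype.card_pos, ⟨fun _ i => (Fintype.equivFin V).symm i, fun _ _ _ => Or.inl rfl⟩, ?_⟩
  intro r _
  exact ⟨0, Fintype.equivFin V (r 0), Or.inl (by simp)⟩

theorem copsWin_copNumber [Fintype V] [Nonempty V] (G : SimpleGraph V) :
    G.CopsWin G.copNumber :=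
  Nat.sInf_mem (s := {k : ℕ | G.CopsWin k}) ⟨_, G.copsWin_card⟩

end SimpleGraph

/-!
A state of the game consists of the positions of the cops and of the robber, with the cops to move;
`SimpleGraph.Forces` says that the cops can force a state of a given kind, and on a finite graph
such positional information can be turned into a strategy in the sense of the statement
(`SimpleGraph.copsWin_of_forces`). The robber is confined to smaller and smaller territories `U`;
leaving the territory counts as a success of the cops (`SimpleGraph.Clears`).

With `L = log n`, put `κ = 2 ^ ⌊√L⌋` and `T = ⌊√L⌋ - 1`. As long as the territory induces a graph
with a geodesic of length more than `2 ^ (T - 1)`, one cop can guard this geodesic for good, so that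
the robber is confined to a component of the rest (`SimpleGraph.clears_succ_of_geodesic`). This
costs `O(n / κ)` cops. If at most `κ ^ T ≤ n / κ` vertices are left, the cops occupy all of them.

Otherwise the territory has diameter at most `2 ^ (T - 1)` and more than `κ ^ T` vertices, and for
each `i < T` a team of `O(L n / κ)` cops is placed at random in it. Such a team meets the ball of
radius `2 ^ i` around every set `A`, provided that this ball has at least `κ |A|` vertices, at least
`|A|` times (`exists_seq_card_le_card_filter_mem`, a union bound over all `A`). By Hall's theorem,
for every set `D` the team can occupy `D` within `2 ^ i` moves, apart from a subset `A` whose ball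
has at most `κ |A|` vertices (`SimpleGraph.exists_nonexpanding_subset`). If `D` contains the
robber's position after `2 ^ i - 1` moves, an uncaught robber is then in `A`, and `2 ^ i` moves later
he is in the ball of radius `2 ^ i` around `A`, which takes the role of `D` for the next team. The
sets `D` grow at most by the factor `κ` each time, but the last ball is the whole territory by the
bound on the diameter: a contradiction (`SimpleGraph.clears_of_small_diameter`).
-/

namespace SimpleGraph

/-! ### Forcing in the game -/

/-- In one turn a player stays or moves to a neighbour. -/
def Step {V : Type*} (G : SimpleGraph V) (x y : V) : Prop :=
  y = x ∨ G.Adj x y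

/-- `G.Forces T p r`: with the cops at `p`, the robber at `r` and the cops to move, the cops can
force the game to reach, after finitely many rounds, a state (again with the cops to move)
satisfying `T`. -/
inductive Forces {V ι : Type*} (G : SimpleGraph V) (T : (ι → V) → V → Prop) :
    (ι → V) → V → Prop
  | done {p : ι → V} {r : V} (h : T p r) : Forces G T p r
  | step {p : ι → V} {r : V} (p' : ι → V) (hp : ∀ i, G.Step (p i) (p' i))
      (h : ∀ r', G.Step r r' → Forces G T p' r') : Forces G T p r

/-- Some cop can move onto the robber in the current turn of the cops. -/
def Caught {V ι : Type*} (G : SimpleGraph V) (p : ι → V) (r : V) : Prop :=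
  ∃ i, G.Step (p i) r

variable {V : Type*} {G : SimpleGraph V}

theorem Forces.trans {ι : Type*} {T T' : (ι → V) → V → Prop} {p : ι → V} {r : V}
    (h : G.Forces T p r) (hT : ∀ p r, T p r → G.Forces T' p r) : G.Forces T' p r := by
  induction h with
  | done h => exact hT _ _ h
  | step p' hp _ ih => exact .step p' hp ih

theorem Forces.mono {ι : Type*} {T T' : (ι → V) → V → Prop} {p : ι → V} {r : V}
    (h : G.Forces T p r) (hT : ∀ p r, T p r → T' p r) : G.Forces T' p r :=
  h.trans fun p r hpr => .done (hT p r hpr)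

/-- A fixed sequence of cop moves forces `T` as soon as it meets `T` against every route of the
robber: otherwise a robber who always keeps out of the forced states has a route avoiding `T`. -/
theorem forces_of_script {ι : Type*} {T : (ι → V) → V → Prop} (q : ℕ → ι → V)
    (hq : ∀ t i, G.Step (q t i) (q (t + 1) i)) (r₀ : V)
    (h : ∀ r : ℕ → V, r 0 = r₀ → G.IsRobberRoute r → ∃ t, T (q t) (r t)) :
    G.Forces T (q 0) r₀ := by
  by_contra hcon
  have key : ∀ t x, ¬ G.Forces T (q t) x →
      ∃ y, G.Step x y ∧ ¬ G.Forces T (q (t + 1)) y := by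
    intro t x hx
    by_contra! hy
    exact hx (.step (q (t + 1)) (hq t) hy)
  choose! nxt hn1 hn2 using key
  let r : ℕ → V := fun t => Nat.rec r₀ (fun t x => nxt t x) t
  have hr : ∀ t, ¬ G.Forces T (q t) (r t) := by
    intro t
    induction t with
    | zero => exact hcon
    | succ t ih => exact hn2 t _ ih
  obtain ⟨t, ht⟩ := h r rfl (fun t => hn1 t _ (hr t))
  exact hr t (.done ht)

theorem Walk.step_getVert {x y : V} (w : G.Walk x y) (t : ℕ) :
    G.Step (w.getVert t) (w.getVert (t + 1)) := by
  rcases lt_or_ge t w.length with h | h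
  · exact Or.inr (w.adj_getVert_succ h)
  · left
    rw [Walk.getVert_of_length_le _ h, Walk.getVert_of_length_le _ (h.trans (Nat.le_succ t))]

/-- In a connected graph finitely many cops can go to any prescribed vertices. -/
theorem forces_goto {k : ℕ} (hG : G.Connected) (p f : Fin k → V) (r : V) :
    G.Forces (fun q _ => q = f) p r := by
  have w : ∀ i, G.Walk (p i) (f i) := fun i => (hG.preconnected _ _).some
  have := forces_of_script (G := G) (T := fun q _ => q = f) (fun t i => (w i).getVert t)
    (fun t i => (w i).step_getVert t)
    r (fun r' _ _ => ⟨Finset.univ.sup fun i => (w i).length, funext fun i =>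
      Walk.getVert_of_length_le _ (Finset.le_sup (f := fun i => (w i).length)
        (Finset.mem_univ i))⟩)
  simpa using this

/-- While a team plays its own strategy, an additional cop can keep an invariant `I` relating her
position to that of the robber, up to the moment when the target `T'` is reached. -/
theorem Forces.guarded {k : ℕ} {I : V → V → Prop}
    {T : (Fin k → V) → V → Prop} {T' : (Fin (k + 1) → V) → V → Prop}
    (hI : ∀ x r, I x r → (∀ p : Fin k → V, T' (Fin.cons x p) r) ∨
      ∃ x', G.Step x x' ∧ ∀ r', G.Step r r' → I x' r')
    (hT : ∀ p r x, T p r → I x r → T' (Fin.cons x p) r)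
    {p : Fin k → V} {r : V} (h : G.Forces T p r) :
    ∀ x, I x r → G.Forces T' (Fin.cons x p) r := by
  induction h with
  | @done p r h => exact fun x hx => .done (hT p r x h hx)
  | @step p r p' hp _ ih =>
    intro x hx
    rcases hI x r hx with h | ⟨x', hxx', hx'⟩
    · exact .done (h p)
    refine .step (Fin.cons x' p') (fun i => ?_) fun r' hr' => ih r' hr' x' (hx' r' hr')
    refine Fin.cases ?_ (fun i => ?_) i
    · simpa using hxx'
    · simpa using hp i

/-! ### From forcing to winning strategies -/

/-- The cops can force `T` within `n` rounds. -/
def ForcesIn {ι : Type*} (G : SimpleGraph V) (T : (ι → V) → V → Prop) :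
    ℕ → (ι → V) → V → Prop
  | 0, p, r => T p r
  | n + 1, p, r => T p r ∨ ∃ p' : ι → V, (∀ i, G.Step (p i) (p' i)) ∧
      ∀ r', G.Step r r' → ForcesIn G T n p' r'

theorem ForcesIn.mono {ι : Type*} {T : (ι → V) → V → Prop} {m n : ℕ} (hmn : m ≤ n)
    {p : ι → V} {r : V} (h : G.ForcesIn T m p r) : G.ForcesIn T n p r := by
  induction n generalizing m p r with
  | zero =>
    obtain rfl : m = 0 := by omega
    exact h
  | succ n ih =>
    cases m with
    | zero => exact Or.inl h
    | succ m =>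
      rcases h with h | ⟨p', hp, h⟩
      · exact Or.inl h
      · exact Or.inr ⟨p', hp, fun r' hr' => ih (by omega) (h r' hr')⟩

theorem Forces.exists_forcesIn [Fintype V] {ι : Type*} {T : (ι → V) → V → Prop} {p : ι → V}
    {r : V} (h : G.Forces T p r) : ∃ n, G.ForcesIn T n p r := by
  induction h with
  | done h => exact ⟨0, h⟩
  | @step p r p' hp _ ih =>
    choose! n hn using ih
    exact ⟨Finset.univ.sup n + 1, Or.inr ⟨p', hp, fun r' hr' =>
      (hn r' hr').mono (Finset.le_sup (Finset.mem_univ r'))⟩⟩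

/-- In every state there is a move of the cops that catches the robber if this is possible at once
and otherwise decreases the number of rounds that remain. -/
theorem exists_descending_move {ι : Type*} (G : SimpleGraph V) (p : ι → V) (r : V) :
    ∃ p' : ι → V, (∀ i, G.Step (p i) (p' i)) ∧ (G.Caught p r → ∃ i, p' i = r) ∧
      (¬ G.Caught p r → ∀ n, G.ForcesIn G.Caught n p r →
        ∃ m < n, ∀ r', G.Step r r' → G.ForcesIn G.Caught m p' r') := by
  classical
  by_cases hc : G.Caught p r
  · obtain ⟨i, hi⟩ := hc
    refine ⟨Function.update p i r, fun j => ?_, fun _ => ⟨i, by simp⟩, fun h => (h ⟨i, hi⟩).elim⟩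
    by_cases hj : j = i
    · subst hj; simpa using hi
    · simp [hj, Step]
  by_cases hn : ∃ n, G.ForcesIn G.Caught n p r
  · have h0 := Nat.find_spec hn
    have hmin := fun n h => Nat.find_min' hn (m := n) h
    revert h0 hmin
    generalize Nat.find hn = n₀
    intro h0 hmin
    cases n₀ with
    | zero => exact (hc h0).elim
    | succ m =>
      rcases h0 with h0 | ⟨p', hp, h0⟩
      · exact (hc h0).elim
      · exact ⟨p', hp, fun h => (hc h).elim, fun _ n h => ⟨m, hmin n h, h0⟩⟩
  · exact ⟨p, fun i => Or.inl rfl, fun h => (hc h).elim, fun _ n h => (hn ⟨n, h⟩).elim⟩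

/-- Playing the moves of `exists_descending_move` in every state is a winning strategy. Each move
depends on the current state only, so the history serves just to compute that state. -/
theorem copsWin_of_forces [Fintype V] {k : ℕ} (hk : 1 ≤ k) (p₀ : Fin k → V)
    (h : ∀ r, G.Forces G.Caught p₀ r) : G.CopsWin k := by
  choose σ hσ1 hσ2 hσ3 using fun p : Fin k → V => exists_descending_move G p
  let pos : List V → Fin k → V := fun h => List.rec p₀ (fun v _ p => σ p v) h
  refine ⟨hk, ⟨pos, fun h v i => hσ1 _ _ _⟩, fun r hr => ?_⟩
  have key : ∀ n t, G.ForcesIn G.Caught n (pos (robberHistory r t)) (r t) →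
      ∃ (t : ℕ) (i : Fin k), pos (robberHistory r t) i = r t ∨
        pos (robberHistory r (t + 1)) i = r t := by
    intro n
    induction n using Nat.strong_induction_on with
    | _ n ih =>
      intro t ht
      by_cases hc : G.Caught (pos (robberHistory r t)) (r t)
      · obtain ⟨i, hi⟩ := hσ2 _ _ hc
        exact ⟨t, i, Or.inr hi⟩
      · obtain ⟨m, hm, hmr⟩ := hσ3 _ _ hc n ht
        exact ih m hm (t + 1) (hmr _ (hr t))
  obtain ⟨n, hn⟩ := (h (r 0)).exists_forcesIn
  exact key n 0 hn

/-! ### Clearing a territory -/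

/-- `k` cops, starting anywhere, can force the robber to leave the territory `U` or to be caught.
The cops may move in all of `G`. -/
def Clears (G : SimpleGraph V) (U : Finset V) (k : ℕ) : Prop :=
  ∀ (p : Fin k → V) (r : V), G.Forces (fun p r => r ∉ U ∨ G.Caught p r) p r

theorem Caught.cons {k : ℕ} {p : Fin k → V} {r : V} (h : G.Caught p r) (x : V) :
    G.Caught (Fin.cons x p : Fin (k + 1) → V) r := by
  obtain ⟨i, hi⟩ := h
  exact ⟨i.succ, by simpa using hi⟩

theorem Clears.mono {U : Finset V} {k l : ℕ} (hkl : k ≤ l) (h : G.Clears U k) :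
    G.Clears U l := by
  induction l, hkl using Nat.le_induction with
  | base => exact h
  | succ l _ ih =>
    intro p r
    rw [← Fin.cons_self_tail p]
    refine Forces.guarded (I := fun _ _ => True)
      (fun x _ _ => Or.inr ⟨x, Or.inl rfl, fun _ _ => trivial⟩) ?_
      (ih (Fin.tail p) r) (p 0) trivial
    rintro p r x (h | h) -
    · exact Or.inl h
    · exact Or.inr (h.cons x)

/-- Cops on all vertices of `U` clear `U`. -/
theorem clears_of_card_le (hG : G.Connected) {U : Finset V} {k : ℕ} (h : U.card ≤ k) :
    G.Clears U k := by
  refine Clears.mono h fun p r => ?_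
  refine (forces_goto hG p (fun i => (U.equivFin.symm i : V)) r).mono ?_
  rintro q r rfl
  by_cases hr : r ∈ U
  · exact Or.inr ⟨U.equivFin ⟨r, hr⟩, by simp [Step]⟩
  · exact Or.inl hr

theorem copNumber_le_of_clears [Fintype V] (hG : G.Connected) {k : ℕ} (hk : 1 ≤ k)
    (h : G.Clears Finset.univ k) : G.copNumber ≤ k := by
  obtain ⟨v⟩ := hG.nonempty
  refine Nat.sInf_le (copsWin_of_forces hk (fun _ => v) fun r => (h _ r).mono ?_)
  rintro p r (h | h)
  · simp at h
  · exact h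

/-! ### Guarding a geodesic -/

/-- The subgraph of `G` induced on `U`, as a graph on the whole vertex type: the vertices outside
`U` are isolated. -/
def inside (G : SimpleGraph V) (U : Finset V) : SimpleGraph V where
  Adj x y := G.Adj x y ∧ x ∈ U ∧ y ∈ U
  symm := ⟨fun _ _ h => ⟨h.1.symm, h.2.2, h.2.1⟩⟩
  loopless := ⟨fun _ h => G.loopless.irrefl _ h.1⟩

theorem inside_le (G : SimpleGraph V) (U : Finset V) : G.inside U ≤ G := fun _ _ h => h.1

theorem inside_univ [Fintype V] (G : SimpleGraph V) : G.inside Finset.univ = G := by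
  ext x y
  simp [inside]

/-- The graph induced on `U` is connected (or `U` is empty). -/
def ConnectedOn (G : SimpleGraph V) (U : Finset V) : Prop :=
  ∀ x ∈ U, ∀ y ∈ U, (G.inside U).Reachable x y

theorem mem_of_reachable_inside {U : Finset V} {x y : V} (h : (G.inside U).Reachable x y)
    (hx : x ∈ U) : y ∈ U := by
  rw [reachable_iff_reflTransGen] at h
  induction h with
  | refl => exact hx
  | tail _ h _ => exact h.2.2

/-- The component of `r` in the graph induced on `W`: from it one cannot step to the rest of `W`. -/
theorem exists_component (G : SimpleGraph V) {W : Finset V} {r : V} (hr : r ∈ W) :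
    ∃ C ⊆ W, r ∈ C ∧ G.ConnectedOn C ∧ ∀ x ∈ C, ∀ y ∈ W, G.Adj x y → y ∈ C := by
  classical
  refine ⟨W.filter fun y => (G.inside W).Reachable r y, Finset.filter_subset _ _, by simp [hr],
    ?_, ?_⟩
  · set C := W.filter fun y => (G.inside W).Reachable r y with hC
    have key : ∀ y, (G.inside W).Reachable r y → (G.inside C).Reachable r y := by
      intro y hy
      rw [reachable_iff_reflTransGen] at hy
      induction hy with
      | refl => rfl
      | @tail b c hb hbc ih =>
        rw [← reachable_iff_reflTransGen] at hb
        refine ih.trans (Adj.reachable ⟨hbc.1, ?_, ?_⟩)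
        · simpa [hC] using ⟨hbc.2.1, hb⟩
        · simpa [hC] using ⟨hbc.2.2, hb.trans (Adj.reachable hbc)⟩
    intro x hx y hy
    exact (key x (Finset.mem_filter.1 hx).2).symm.trans (key y (Finset.mem_filter.1 hy).2)
  · intro x hx y hy hxy
    obtain ⟨hx, hrx⟩ := Finset.mem_filter.1 hx
    exact Finset.mem_filter.2 ⟨hy, hrx.trans (Adj.reachable ⟨hxy, hx, hy⟩)⟩

theorem Walk.dist_getVert_of_length_eq {H : SimpleGraph V} {a b : V} (w : H.Walk a b)
    (hw : w.length = H.dist a b) {j : ℕ} (hj : j ≤ w.length) : H.dist a (w.getVert j) = j := by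
  apply le_antisymm
  · refine (dist_le (w.take j)).trans ?_
    simp
  · obtain ⟨q, hq⟩ := (w.take j).reachable.exists_walk_length_eq_dist
    have := dist_le (q.append (w.drop j))
    rw [Walk.length_append, Walk.drop_length] at this
    omega

theorem dist_le_add_one_of_step {U : Finset V} (hU : G.ConnectedOn U) {a x y : V} (ha : a ∈ U)
    (hx : x ∈ U) (hy : y ∈ U) (h : G.Step x y) :
    (G.inside U).dist a y ≤ (G.inside U).dist a x + 1 := by
  rcases h with rfl | h
  · omega
  · obtain ⟨w, hw⟩ := (hU a ha x hx).exists_walk_length_eq_dist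
    have h' : (G.inside U).Adj x y := ⟨h, hx, hy⟩
    have := dist_le (w.concat h')
    rw [Walk.length_concat] at this
    omega

/-- One cop can guard a geodesic of the graph induced on `U`: she moves along it as the shadow of
the robber does, the shadow being the vertex of the geodesic at the same distance from its start
(or the end of the geodesic, if the robber is further away). Afterwards the robber is confined to a
component of what remains of `U`. -/
theorem clears_succ_of_geodesic (hG : G.Connected) {U : Finset V} (hU : G.ConnectedOn U)
    {a b : V} (ha : a ∈ U) (hb : b ∈ U) {k : ℕ}
    (ih : ∀ U' ⊆ U, G.ConnectedOn U' → U'.card + (G.inside U).dist a b ≤ U.card →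
      G.Clears U' k) : G.Clears U (k + 1) := by
  classical
  obtain ⟨w, hw⟩ := (hU a ha b hb).exists_walk_length_eq_dist
  set N := w.length with hN
  set P : ℕ → V := w.getVert with hP
  have hdist : ∀ j ≤ N, (G.inside U).dist a (P j) = j := fun j hj =>
    w.dist_getVert_of_length_eq hw hj
  have hPU : ∀ j, P j ∈ U := fun j => mem_of_reachable_inside (w.take j).reachable ha
  have hPstep : ∀ j, G.Step (P j) (P (j + 1)) := fun j =>
    (w.step_getVert j).imp_right fun h => inside_le G U h
  have hPnear : ∀ i j, i ≤ j + 1 → j ≤ i + 1 → G.Step (P i) (P j) := by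
    intro i j h1 h2
    obtain h | h | h : j = i ∨ j = i + 1 ∨ i = j + 1 := by omega
    · exact Or.inl (by rw [h])
    · rw [h]; exact hPstep i
    · rw [h]; exact (hPstep j).imp Eq.symm fun h => h.symm
  -- The index on the geodesic of the shadow of the robber.
  let s : V → ℕ := fun r => min ((G.inside U).dist a r) N
  have hsN : ∀ r, s r ≤ N := fun r => min_le_right _ _
  have hs : ∀ r ∈ U, ∀ r' ∈ U, G.Step r r' → s r' ≤ s r + 1 ∧ s r ≤ s r' + 1 := by
    intro r hr r' hr' h
    have h1 := dist_le_add_one_of_step hU ha hr hr' h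
    have h2 := dist_le_add_one_of_step hU ha hr' hr (h.imp Eq.symm fun h => h.symm)
    simp only [s]
    omega
  -- The guard is at distance at most one from the shadow.
  let I : V → V → Prop := fun x r => ∃ j ≤ N, x = P j ∧ j ≤ s r + 1 ∧ s r ≤ j + 1
  have hcatch : ∀ x r, I x r → (∃ j ≤ N, r = P j) → G.Step x r := by
    rintro x r ⟨j, hj, rfl, h1, h2⟩ ⟨l, hl, rfl⟩
    have : s (P l) = l := by simp only [s]; rw [hdist l hl]; omega
    rw [this] at h1 h2
    exact hPnear j l h1 h2
  -- The guard walks along the geodesic until she is next to the shadow.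
  have hgain : ∀ d j, N - j = d → ∀ (p : Fin (k + 1) → V) (r : V), p 0 = P j → j ≤ N →
      j ≤ s r + 1 → G.Forces (fun p r => r ∉ U ∨ I (p 0) r) p r := by
    intro d
    induction d with
    | zero =>
      intro j hd p r hp hj h
      exact .done (Or.inr ⟨j, hj, hp, h, by have := hsN r; omega⟩)
    | succ d ihd =>
      intro j hd p r hp hj h
      by_cases hsj : s r ≤ j + 1
      · exact .done (Or.inr ⟨j, hj, hp, h, hsj⟩)
      by_cases hr : r ∈ U
      · refine .step (Function.update p 0 (P (j + 1))) (fun i => ?_) fun r' hr' => ?_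
        · by_cases hi : i = 0
          · subst hi; simpa [hp] using hPstep j
          · simp [hi, Step]
        · by_cases hrU' : r' ∈ U
          · have := (hs r hr r' hrU' hr').2
            exact ihd (j + 1) (by omega) _ r' (by simp) (by omega) (by omega)
          · exact .done (Or.inl hrU')
      · exact .done (Or.inl hr)
  intro p r
  refine (forces_goto hG p (fun _ => a) r).trans ?_
  rintro _ r rfl
  refine (hgain (N - 0) 0 rfl _ r (by simp [hP]) (by omega) (by omega)).trans ?_
  rintro p r (hr | hI)
  · exact .done (Or.inl hr)
  by_cases hrU : r ∈ U
  swap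
  · exact .done (Or.inl hrU)
  by_cases hrP : ∃ j ≤ N, r = P j
  · exact .done (Or.inr ⟨0, hcatch _ _ hI hrP⟩)
  set Q : Finset V := (Finset.range (N + 1)).image P with hQ
  have hmemQ : ∀ x, x ∈ Q ↔ ∃ j ≤ N, x = P j := by
    intro x
    simp [hQ, eq_comm]
  have hQcard : Q.card = N + 1 := by
    rw [hQ, Finset.card_image_of_injOn, Finset.card_range]
    intro i hi j hj hij
    rw [← hdist i (by simpa [Nat.lt_succ_iff] using hi),
      ← hdist j (by simpa [Nat.lt_succ_iff] using hj), hij]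
  have hQU : Q ⊆ U := by
    intro x hx
    obtain ⟨j, _, rfl⟩ := (hmemQ x).1 hx
    exact hPU j
  obtain ⟨C, hCW, hrC, hC, hCadj⟩ := exists_component G (W := U \ Q) (r := r)
    (by simp only [Finset.mem_sdiff, hmemQ]; exact ⟨hrU, hrP⟩)
  have hCcard : C.card + (G.inside U).dist a b ≤ U.card := by
    have h1 := Finset.card_le_card hCW
    have h2 := Finset.card_sdiff_add_card_eq_card hQU
    omega
  have hclear := ih C (hCW.trans Finset.sdiff_subset) hC hCcard (Fin.tail p) r
  rw [← Fin.cons_self_tail p]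
  refine Forces.guarded (I := fun x r => r ∉ U ∨ (I x r ∧ (r ∈ C ∨ r ∈ Q))) ?_ ?_ hclear (p 0)
    (Or.inr ⟨hI, Or.inl hrC⟩)
  · rintro x r (hr | ⟨hI, hr | hr⟩)
    · exact Or.inl fun p => Or.inl hr
    · right
      have hrU : r ∈ U := (Finset.mem_sdiff.1 (hCW hr)).1
      obtain ⟨j, hj, rfl, h1, h2⟩ := hI
      refine ⟨P (s r), hPnear _ _ h1 h2, fun r' hr' => ?_⟩
      by_cases hrU' : r' ∈ U
      · right
        obtain ⟨h3, h4⟩ := hs r hrU r' hrU' hr'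
        refine ⟨⟨s r, hsN r, rfl, h4, h3⟩, ?_⟩
        by_cases hrQ : r' ∈ Q
        · exact Or.inr hrQ
        · rcases hr' with rfl | hadj
          · exact Or.inl hr
          · exact Or.inl (hCadj r hr r' (Finset.mem_sdiff.2 ⟨hrU', hrQ⟩) hadj)
      · exact Or.inl hrU'
    · exact Or.inl fun p => Or.inr ⟨0, by simpa using hcatch x r hI ((hmemQ r).1 hr)⟩
  · rintro p r x hT (hr | ⟨hI, hr | hr⟩)
    · exact Or.inl hr
    · rcases hT with hT | hT
      · exact (hT hr).elim
      · exact Or.inr (hT.cons x)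
    · exact Or.inr ⟨0, by simpa using hcatch x r hI ((hmemQ r).1 hr)⟩

end SimpleGraph

/-! ### Random sequences meeting all large sets often -/

/-- For all assignments `N` of subsets of `U` to subsets of `U`, a suitable sequence of length `m`
meets `N A` at least `|A|` times, for every `A` with `|N A| ≥ κ |A|`. For a uniformly random
sequence `f` in `U`, the expectation of `∑ 2 ^ (|A| - |{j | f j ∈ N A}|)` over these `A` is at most
`∑ (1 / (2 |U|)) ^ |A| ≤ exp (1 / 2) - 1 < 1`. -/
theorem exists_seq_card_le_card_filter_mem {V : Type*} [DecidableEq V] {U : Finset V}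
    (hU : U.Nonempty) (N : Finset V → Finset V) (hN : ∀ A ⊆ U, N A ⊆ U) {κ m : ℕ}
    (hm : 4 * (U.card : ℝ) ≤ Real.exp (κ * m / (2 * U.card))) :
    ∃ f : Fin m → V, ∀ A ⊆ U, A.Nonempty → κ * A.card ≤ (N A).card →
      A.card ≤ (Finset.univ.filter fun j => f j ∈ N A).card := by
  classical
  set u : ℝ := (U.card : ℝ) with hu
  have hu0 : 0 < u := by rw [hu]; exact_mod_cast hU.card_pos
  set 𝒜 := U.powerset.filter fun A => A.Nonempty ∧ κ * A.card ≤ (N A).card with h𝒜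
  let X : (Fin m → V) → Finset V → ℕ := fun f A => (Finset.univ.filter fun j => f j ∈ N A).card
  set Ω := Fintype.piFinset fun _ : Fin m => U with hΩ
  have hΩcard : (Ω.card : ℝ) = u ^ m := by simp [hΩ, hu]
  -- The exponential moment of a single count.
  have hmoment : ∀ A ∈ 𝒜, ∑ f ∈ Ω, (2 : ℝ) ^ A.card * (1 / 2) ^ X f A ≤
      u ^ m * (1 / (2 * u)) ^ A.card := by
    intro A hA
    obtain ⟨hAU, -, hAN⟩ := Finset.mem_filter.1 hA
    have hAU := Finset.mem_powerset.1 hAU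
    have h1 : ∀ f : Fin m → V, ((1 : ℝ) / 2) ^ X f A =
        ∏ j, if f j ∈ N A then (1 / 2 : ℝ) else 1 := by
      intro f
      rw [Finset.prod_ite, Finset.prod_const, Finset.prod_const_one, mul_one]
    have h2 : ∑ x ∈ U, (if x ∈ N A then (1 / 2 : ℝ) else 1) = u - (N A).card / 2 := by
      have : ∀ x, (if x ∈ N A then (1 / 2 : ℝ) else 1) =
          1 - if x ∈ N A then (1 / 2 : ℝ) else 0 := by
        intro x; split_ifs <;> norm_num
      simp_rw [this]
      rw [Finset.sum_sub_distrib, ← Finset.sum_filter, Finset.filter_mem_eq_inter,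
        Finset.inter_eq_right.2 (hN A hAU)]
      simp [hu, div_eq_mul_inv]
    have h3 : ∑ f ∈ Ω, ((1 : ℝ) / 2) ^ X f A = (u - (N A).card / 2) ^ m := by
      simp_rw [h1]
      rw [hΩ, ← Finset.prod_univ_sum (fun _ : Fin m => U)
        (fun _ x => if x ∈ N A then (1 / 2 : ℝ) else 1)]
      simp only [h2, Finset.prod_const, Finset.card_univ, Fintype.card_fin]
    have hNu : ((N A).card : ℝ) ≤ u := by
      rw [hu]; exact_mod_cast Finset.card_le_card (hN A hAU)
    have h4 : u - (N A).card / 2 ≤ u * Real.exp (-(κ * A.card / (2 * u))) := by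
      have h5 : ((κ * A.card : ℕ) : ℝ) ≤ (N A).card := by exact_mod_cast hAN
      push_cast at h5
      have h6 := Real.add_one_le_exp (-(κ * A.card / (2 * u) : ℝ))
      calc u - (N A).card / 2 ≤ u * (-(κ * A.card / (2 * u)) + 1) := by
            have : u * (-(κ * A.card / (2 * u)) + 1) = u - κ * A.card / 2 := by field_simp; ring
            rw [this]; linarith
        _ ≤ _ := by gcongr
    have h7 : Real.exp (-(κ * A.card / (2 * u))) ^ m ≤ (1 / (4 * u)) ^ A.card := by
      have h8 : Real.exp (-(κ * A.card / (2 * u))) ^ m =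
          (Real.exp (κ * m / (2 * u)))⁻¹ ^ A.card := by
        rw [← Real.exp_nat_mul, ← Real.exp_neg, ← Real.exp_nat_mul]
        congr 1
        ring
      rw [h8, one_div]
      gcongr
    rw [← Finset.mul_sum, h3]
    calc (2 : ℝ) ^ A.card * (u - (N A).card / 2) ^ m
        ≤ 2 ^ A.card * (u * Real.exp (-(κ * A.card / (2 * u)))) ^ m := by
          gcongr
          linarith
      _ = 2 ^ A.card * (u ^ m * Real.exp (-(κ * A.card / (2 * u))) ^ m) := by rw [mul_pow]
      _ ≤ 2 ^ A.card * (u ^ m * (1 / (4 * u)) ^ A.card) := by gcongr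
      _ = u ^ m * (2 * (1 / (4 * u))) ^ A.card := by rw [mul_pow]; ring
      _ = u ^ m * (1 / (2 * u)) ^ A.card := by congr 2; field_simp; norm_num
  have hsum : ∑ A ∈ 𝒜, (1 / (2 * u)) ^ A.card < 1 := by
    have h1 : ∑ A ∈ U.powerset, (1 / (2 * u)) ^ A.card = (1 + 1 / (2 * u)) ^ U.card := by
      have := Finset.prod_one_add (f := fun _ : V => 1 / (2 * u)) U
      simpa using this.symm
    have h2 : ∑ A ∈ 𝒜, (1 / (2 * u)) ^ A.card + 1 ≤ ∑ A ∈ U.powerset, (1 / (2 * u)) ^ A.card := by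
      have hempty : (∅ : Finset V) ∉ 𝒜 := by simp [h𝒜]
      have : insert ∅ 𝒜 ⊆ U.powerset := by
        intro A hA
        rcases Finset.mem_insert.1 hA with rfl | hA
        · simp
        · exact (Finset.mem_filter.1 hA).1
      have h := Finset.sum_le_sum_of_subset_of_nonneg (f := fun A => (1 / (2 * u)) ^ A.card) this
        (fun A _ _ => by positivity)
      rw [Finset.sum_insert hempty] at h
      simp only [Finset.card_empty, pow_zero] at h
      linarith
    have h3 : (1 + 1 / (2 * u)) ^ U.card ≤ Real.exp (1 / 2) := by
      have : Real.exp (1 / 2) = Real.exp (1 / (2 * u)) ^ U.card := by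
        rw [← Real.exp_nat_mul, ← hu]; congr 1; field_simp
      rw [this]
      gcongr
      linarith [Real.add_one_le_exp (1 / (2 * u))]
    have h4 : Real.exp (1 / 2) < 2 := by
      have h5 : Real.exp (1 / 2) * Real.exp (1 / 2) = Real.exp 1 := by
        rw [← Real.exp_add]; norm_num
      nlinarith [Real.exp_one_lt_d9, Real.exp_pos (1 / 2)]
    linarith
  have hlt : ∑ f ∈ Ω, ∑ A ∈ 𝒜, (2 : ℝ) ^ A.card * (1 / 2) ^ X f A < ∑ _f ∈ Ω, 1 := by
    rw [Finset.sum_comm]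
    calc _ ≤ ∑ A ∈ 𝒜, u ^ m * (1 / (2 * u)) ^ A.card := Finset.sum_le_sum hmoment
      _ = u ^ m * ∑ A ∈ 𝒜, (1 / (2 * u)) ^ A.card := by rw [Finset.mul_sum]
      _ < u ^ m * 1 := by gcongr
      _ = _ := by simp [hΩcard]
  obtain ⟨f, -, hflt⟩ := Finset.exists_lt_of_sum_lt hlt
  refine ⟨f, fun A hAU hA hAN => ?_⟩
  by_contra! hcon
  have hA𝒜 : A ∈ 𝒜 := Finset.mem_filter.2 ⟨Finset.mem_powerset.2 hAU, hA, hAN⟩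
  have h1 := Finset.single_le_sum (f := fun A => (2 : ℝ) ^ A.card * (1 / 2) ^ X f A)
    (fun A _ => by positivity) hA𝒜
  have h2 : (1 : ℝ) ≤ 2 ^ A.card * (1 / 2) ^ X f A := by
    have h3 : (2 : ℝ) ^ X f A ≤ 2 ^ A.card := pow_le_pow_right₀ (by norm_num) hcon.le
    rw [one_div, inv_pow, ← div_eq_mul_inv, one_le_div (by positivity)]
    exact h3
  linarith

namespace SimpleGraph

/-! ### Balls and covering sets -/

/-- The vertices joined to `A` by a walk of length at most `ρ`. -/
noncomputable def ballAround {V : Type*} [Fintype V] (H : SimpleGraph V) (A : Finset V) (ρ : ℕ) :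
    Finset V := by
  classical exact Finset.univ.filter fun y => ∃ x ∈ A, ∃ w : H.Walk x y, w.length ≤ ρ

variable {V : Type*} [Fintype V] {G H : SimpleGraph V}

theorem mem_ballAround {A : Finset V} {ρ : ℕ} {y : V} :
    y ∈ H.ballAround A ρ ↔ ∃ x ∈ A, ∃ w : H.Walk x y, w.length ≤ ρ := by
  simp [ballAround]

theorem ballAround_inside_subset {U A : Finset V} (hA : A ⊆ U) (ρ : ℕ) :
    (G.inside U).ballAround A ρ ⊆ U := by
  intro y hy
  obtain ⟨x, hx, w, -⟩ := mem_ballAround.1 hy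
  exact mem_of_reachable_inside w.reachable (hA hx)

theorem ballAround_union [DecidableEq V] (A B : Finset V) (ρ : ℕ) :
    H.ballAround (A ∪ B) ρ = H.ballAround A ρ ∪ H.ballAround B ρ := by
  ext y
  simp only [mem_ballAround, Finset.mem_union, or_and_right, exists_or]

/-- Suppose that the cops at `f` meet the `ρ`-ball of every expanding set `A ⊆ U` at least `|A|`
times. Then in each `D ⊆ U` there is a set `A` which does not expand, such that the cops can occupy
`D \ A` along walks of length at most `ρ`. Here `A` is a largest nonexpanding subset of `D`; by its
maximality all subsets of `D \ A` expand, and Hall's theorem assigns cops to the vertices. -/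
theorem exists_nonexpanding_subset [DecidableEq V] {U : Finset V} {ρ κ m : ℕ} {f : Fin m → V}
    (hf : ∀ A ⊆ U, A.Nonempty → κ * A.card ≤ (H.ballAround A ρ).card →
      A.card ≤ (Finset.univ.filter fun j => f j ∈ H.ballAround A ρ).card)
    {D : Finset V} (hD : D ⊆ U) :
    ∃ A ⊆ D, (H.ballAround A ρ).card ≤ κ * A.card ∧
      ∃ τ : Fin m → V, (∀ j, ∃ w : H.Walk (f j) (τ j), w.length ≤ ρ) ∧
        ∀ x ∈ D \ A, ∃ j, τ j = x := by
  classical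
  obtain ⟨A, hA, hmax⟩ := Finset.exists_max_image
    (D.powerset.filter fun A => (H.ballAround A ρ).card ≤ κ * A.card) Finset.card
    ⟨∅, by simp [Finset.card_eq_zero, Finset.eq_empty_iff_forall_notMem, mem_ballAround]⟩
  obtain ⟨hAD, hAκ⟩ := Finset.mem_filter.1 hA
  have hAD := Finset.mem_powerset.1 hAD
  refine ⟨A, hAD, hAκ, ?_⟩
  have hexp : ∀ S ⊆ D \ A, S.Nonempty → κ * S.card ≤ (H.ballAround S ρ).card := by
    intro S hS hSne
    by_contra! hcon
    have hdisj : Disjoint A S := by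
      rw [Finset.disjoint_left]
      intro x hxA hxS
      exact (Finset.mem_sdiff.1 (hS hxS)).2 hxA
    have hcard := Finset.card_union_of_disjoint hdisj
    have h1 : A ∪ S ∈ D.powerset.filter fun A => (H.ballAround A ρ).card ≤ κ * A.card := by
      refine Finset.mem_filter.2 ⟨Finset.mem_powerset.2 (Finset.union_subset hAD
        (hS.trans Finset.sdiff_subset)), ?_⟩
      rw [ballAround_union, hcard, mul_add]
      exact (Finset.card_union_le _ _).trans (add_le_add hAκ hcon.le)
    have h2 := hmax _ h1
    have h3 := hSne.card_pos
    omega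
  let t : {x // x ∈ D \ A} → Finset (Fin m) := fun x =>
    Finset.univ.filter fun j => f j ∈ H.ballAround {x.1} ρ
  have hall : ∀ S : Finset {x // x ∈ D \ A}, S.card ≤ (S.biUnion t).card := by
    intro S
    rcases S.eq_empty_or_nonempty with rfl | hS
    · simp
    set S' := S.map (Function.Embedding.subtype _) with hS'
    have hsub : S' ⊆ D \ A := by
      intro x hx
      obtain ⟨y, -, rfl⟩ := Finset.mem_map.1 hx
      exact y.2
    have hne : S'.Nonempty := by simpa [hS'] using hS
    have h1 := hf S' (hsub.trans (Finset.sdiff_subset.trans hD)) hne (hexp S' hsub hne)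
    rw [hS', Finset.card_map] at h1
    refine h1.trans (Finset.card_le_card ?_)
    intro j hj
    obtain ⟨x, hx, w, hw⟩ := mem_ballAround.1 (Finset.mem_filter.1 hj).2
    obtain ⟨y, hy, rfl⟩ := Finset.mem_map.1 hx
    exact Finset.mem_biUnion.2 ⟨y, hy, Finset.mem_filter.2 ⟨Finset.mem_univ _,
      mem_ballAround.2 ⟨y.1, Finset.mem_singleton_self _, w, hw⟩⟩⟩
  obtain ⟨g, hginj, hg⟩ := (Finset.all_card_le_biUnion_card_iff_exists_injective t).1 hall
  have hτ : ∀ j, ∃ y, (∃ w : H.Walk (f j) y, w.length ≤ ρ) ∧ ∀ x, g x = j → y = x.1 := by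
    intro j
    by_cases hj : ∃ x, g x = j
    · obtain ⟨x, rfl⟩ := hj
      obtain ⟨z, hz, w, hw⟩ := mem_ballAround.1 (Finset.mem_filter.1 (hg x)).2
      obtain rfl := Finset.mem_singleton.1 hz
      exact ⟨x.1, ⟨w.reverse, by simpa using hw⟩, fun y hy => by rw [hginj hy]⟩
    · exact ⟨f j, ⟨.nil, by simp⟩, fun x hx => (hj ⟨x, hx⟩).elim⟩
  choose τ hτ1 hτ2 using hτ
  exact ⟨τ, hτ1, fun x hx => ⟨g ⟨x, hx⟩, hτ2 _ _ rfl⟩⟩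

/-! ### Territories of small diameter -/

theorem exists_walk_inside_of_route {V : Type*} {G : SimpleGraph V} {U : Finset V} {r : ℕ → V}
    (hr : G.IsRobberRoute r)
    (hrU : ∀ t, r t ∈ U) (t d : ℕ) :
    ∃ w : (G.inside U).Walk (r t) (r (t + d)), w.length ≤ d := by
  induction d with
  | zero => exact ⟨.nil, by simp⟩
  | succ d ih =>
    obtain ⟨w, hw⟩ := ih
    rcases hr (t + d) with h | h
    · exact ⟨w.copy rfl h.symm, by simp; omega⟩
    · have h' : (G.inside U).Adj (r (t + d)) (r (t + (d + 1))) := ⟨h, hrU _, hrU _⟩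
      exact ⟨w.concat h', by rw [Walk.length_concat]; omega⟩

/-- Teams of `m` cops, one for each `i < T`, clear a connected territory of diameter at most
`2 ^ (T - 1)` with more than `κ ^ T` vertices. If the robber starts at `v`, put `D₀ = {v}`, and let
`Aᵢ` be a nonexpanding subset of `Dᵢ` at radius `2 ^ i` such that team `i` can occupy `Dᵢ \ Aᵢ`
within `2 ^ i` moves, and `Dᵢ₊₁` the ball of radius `2 ^ i` around `Aᵢ`. After his move number
`2 ^ i - 1` an uncaught robber is in `Dᵢ`, since if he is not in `Aᵢ` a cop of team `i` catches him
at once. Hence `D_T` would be all of `U`, but it has at most `κ ^ T` elements. -/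
theorem clears_of_small_diameter (hG : G.Connected) {U : Finset V} {κ m T : ℕ} (hT : 1 ≤ T)
    (hm : 4 * (U.card : ℝ) ≤ Real.exp (κ * m / (2 * U.card))) (hcard : κ ^ T < U.card)
    (hdiam : ∀ x ∈ U, ∀ y ∈ U, ∃ w : (G.inside U).Walk x y, w.length ≤ 2 ^ (T - 1)) :
    G.Clears U (T * m) := by
  classical
  set H := G.inside U with hH
  have hUne : U.Nonempty := Finset.card_pos.1 (by omega)
  have hf : ∀ i : ℕ, ∃ f : Fin m → V, ∀ A ⊆ U, A.Nonempty →
      κ * A.card ≤ (H.ballAround A (2 ^ i)).card →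
      A.card ≤ (Finset.univ.filter fun j => f j ∈ H.ballAround A (2 ^ i)).card := fun i =>
    exists_seq_card_le_card_filter_mem hUne (fun A => H.ballAround A (2 ^ i))
      (fun A hA => ballAround_inside_subset hA _) hm
  choose f hf using hf
  have hA : ∀ (i : ℕ) (D : Finset V), ∃ A : Finset V, ∃ τ : Fin m → V, D ⊆ U → A ⊆ D ∧
      (H.ballAround A (2 ^ i)).card ≤ κ * A.card ∧
      (∀ j, ∃ w : H.Walk (f i j) (τ j), w.length ≤ 2 ^ i) ∧ ∀ x ∈ D \ A, ∃ j, τ j = x := by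
    intro i D
    by_cases hD : D ⊆ U
    · obtain ⟨A, h1, h2, τ, h3, h4⟩ := exists_nonexpanding_subset (hf i) hD
      exact ⟨A, τ, fun _ => ⟨h1, h2, h3, h4⟩⟩
    · exact ⟨∅, f i, fun h => (hD h).elim⟩
  choose A τ hAτ using hA
  intro p v
  let e : Fin T × Fin m ≃ Fin (T * m) := finProdFinEquiv
  refine (forces_goto hG p (fun c => f (e.symm c).1 (e.symm c).2) v).trans ?_
  rintro _ v rfl
  by_cases hv : v ∈ U
  swap
  · exact .done (Or.inl hv)
  let D : ℕ → Finset V := fun i => Nat.rec {v} (fun i D => H.ballAround (A i D) (2 ^ i)) i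
  have hDsucc : ∀ i, D (i + 1) = H.ballAround (A i (D i)) (2 ^ i) := fun i => rfl
  have hDU : ∀ i, D i ⊆ U := by
    intro i
    induction i with
    | zero => simpa [D] using hv
    | succ i ih =>
      rw [hDsucc]
      exact ballAround_inside_subset ((hAτ i _ ih).1.trans ih) _
  have hDcard : ∀ i, (D i).card ≤ κ ^ i := by
    intro i
    induction i with
    | zero => simp [D]
    | succ i ih =>
      obtain ⟨h1, h2, -⟩ := hAτ i _ (hDU i)
      calc (D (i + 1)).card ≤ κ * (A i (D i)).card := h2
        _ ≤ κ * κ ^ i := Nat.mul_le_mul_left _ ((Finset.card_le_card h1).trans ih)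
        _ = κ ^ (i + 1) := by ring
  have hw : ∀ i j, ∃ w : H.Walk (f i j) (τ i (D i) j), w.length ≤ 2 ^ i :=
    fun i => (hAτ i _ (hDU i)).2.2.1
  choose w hw using hw
  let W : Fin T × Fin m → ℕ → V := fun c t => (w c.1 c.2).getVert t
  have := forces_of_script (G := G) (T := fun p r => r ∉ U ∨ G.Caught p r)
    (fun t c => W (e.symm c) t)
    (fun t c => ((w _ _).step_getVert t).imp_right fun h => inside_le G U h) v ?_
  · simpa [W] using this
  intro r hr0 hr
  by_contra! hcon
  have hrU : ∀ t, r t ∈ U := fun t => (hcon t).1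
  have hrA : ∀ i < T, r (2 ^ i - 1) ∈ D i → r (2 ^ i - 1) ∈ A i (D i) := by
    intro i hi hD
    by_contra hrA
    obtain ⟨j, hj⟩ := (hAτ i _ (hDU i)).2.2.2 _ (Finset.mem_sdiff.2 ⟨hD, hrA⟩)
    -- At the cops' next move, number `2 ^ i`, this cop reaches her target.
    refine (hcon (2 ^ i - 1)).2 ⟨e (⟨i, hi⟩, j), ?_⟩
    have h1 := ((w i j).step_getVert (2 ^ i - 1)).imp_right fun h => inside_le G U h
    have h2 : 2 ^ i - 1 + 1 = 2 ^ i := Nat.sub_add_cancel Nat.one_le_two_pow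
    rw [h2, Walk.getVert_of_length_le _ (hw i j)] at h1
    change G.Step (W (⟨i, hi⟩, j) (2 ^ i - 1)) _ at h1
    rw [hj] at h1
    change G.Step (W (e.symm (e (⟨i, hi⟩, j))) (2 ^ i - 1)) _
    rw [Equiv.symm_apply_apply]
    exact h1
  have hrD : ∀ i ≤ T, r (2 ^ i - 1) ∈ D i := by
    intro i
    induction i with
    | zero => intro _; simp [D, hr0]
    | succ i ih =>
      intro hi
      have h := hrA i (by omega) (ih (by omega))
      obtain ⟨w', hw'⟩ := exists_walk_inside_of_route hr hrU (2 ^ i - 1) (2 ^ i)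
      have h2 : 2 ^ i - 1 + 2 ^ i = 2 ^ (i + 1) - 1 := by
        have := Nat.one_le_two_pow (n := i)
        rw [pow_succ]; omega
      rw [← h2, hDsucc]
      exact mem_ballAround.2 ⟨_, h, w', hw'⟩
  obtain ⟨T, rfl⟩ : ∃ S, T = S + 1 := ⟨T - 1, by omega⟩
  have hlast := hrA T (by omega) (hrD T (by omega))
  have hsub : U ⊆ D (T + 1) := by
    intro y hy
    rw [hDsucc]
    exact mem_ballAround.2 ⟨_, hlast, hdiam _ (hrU _) y hy⟩
  have := (Finset.card_le_card hsub).trans (hDcard (T + 1))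
  omega

/-- Long geodesics are guarded one after the other, each by one cop, until the territory left to the
robber is small or has small diameter. Each geodesic takes away more than `2 ^ (T - 1)` vertices,
hence `c` guards are enough; the remaining `M` cops serve for the final stage. -/
theorem clears_of_connectedOn (hG : G.Connected) {κ m T M : ℕ} (hT : 1 ≤ T)
    (hm : 4 * (Fintype.card V : ℝ) ≤ Real.exp (κ * m / (2 * Fintype.card V)))
    (hM1 : κ ^ T ≤ M) (hM2 : T * m ≤ M) (c : ℕ) (U : Finset V) (hU : G.ConnectedOn U)
    (hUc : U.card < c * 2 ^ (T - 1)) : G.Clears U (c + M) := by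
  induction c generalizing U with
  | zero => simp at hUc
  | succ c ih =>
    rcases le_or_gt U.card (κ ^ T) with h | h
    · exact clears_of_card_le hG (by omega)
    by_cases hdiam : ∀ x ∈ U, ∀ y ∈ U, ∃ w : (G.inside U).Walk x y, w.length ≤ 2 ^ (T - 1)
    · refine Clears.mono (k := T * m) (by omega) (clears_of_small_diameter hG hT ?_ h hdiam)
      have h0 : (0 : ℝ) < U.card := by exact_mod_cast (by omega : 0 < U.card)
      have h1 : (U.card : ℝ) ≤ Fintype.card V := by exact_mod_cast U.card_le_univ
      calc 4 * (U.card : ℝ) ≤ 4 * Fintype.card V := by gcongr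
        _ ≤ Real.exp (κ * m / (2 * Fintype.card V)) := hm
        _ ≤ _ := by gcongr
    · push Not at hdiam
      obtain ⟨x, hx, y, hy, hxy⟩ := hdiam
      obtain ⟨w, hw⟩ := (hU x hx y hy).exists_walk_length_eq_dist
      have hD := hxy w
      rw [hw] at hD
      rw [show c + 1 + M = c + M + 1 by ring]
      refine clears_succ_of_geodesic hG hU hx hy fun U' _ hU' hcard => ih U' hU' ?_
      rw [add_mul] at hUc
      omega

/-- A bound with free parameters; `hm` is what the random placement of the teams needs. -/
theorem copNumber_le_of_le_exp (hG : G.Connected) {κ m T M : ℕ} (hT : 1 ≤ T)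
    (hm : 4 * (Fintype.card V : ℝ) ≤ Real.exp (κ * m / (2 * Fintype.card V)))
    (hM1 : κ ^ T ≤ M) (hM2 : T * m ≤ M) :
    G.copNumber ≤ Fintype.card V / 2 ^ (T - 1) + 1 + M := by
  refine copNumber_le_of_clears hG ((Nat.le_add_left 1 _).trans (Nat.le_add_right _ _))
    (clears_of_connectedOn hG hT hm hM1 hM2 _ _ ?_ ?_)
  · intro x _ y _
    rw [inside_univ]
    exact hG.preconnected x y
  · rw [Finset.card_univ, mul_comm]
    exact Nat.lt_mul_div_succ _ (by positivity)

end SimpleGraph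

/-! ### The choice of the parameters -/

namespace SimpleGraph

variable {V : Type*} [Fintype V] {G : SimpleGraph V}

theorem copNumber_le_card (hG : G.Connected) : G.copNumber ≤ Fintype.card V :=
  haveI := hG.nonempty
  Nat.sInf_le G.copsWin_card

/-- With `n` vertices, `L = log n` and `q = ⌊√L⌋`, the parameters are `κ = 2 ^ q` and `T = q - 1`
scales. There are `O(n / κ)` long geodesics, `κ ^ T ≤ n / κ`, and each scale needs
`O(L n / κ)` cops. The bound asked for has room for `n L ^ 3 / κ` cops. -/
theorem copNumber_le_two_mul_log_pow (hG : G.Connected) (hn : 2 ≤ Fintype.card V) :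
    (G.copNumber : ℝ) ≤ 2 * (Fintype.card V : ℝ) * Real.logb 2 (Fintype.card V : ℝ) ^ 3 *
      (2 : ℝ) ^ (-√(Real.logb 2 (Fintype.card V : ℝ))) := by
  set N := Fintype.card V with hN
  set n : ℝ := (N : ℝ) with hnN
  set L := Real.logb 2 n with hL
  set s := √L with hs
  have hn2 : (2 : ℝ) ≤ n := by rw [hnN]; exact_mod_cast hn
  have hL1 : 1 ≤ L := by
    rw [hL, Real.le_logb_iff_rpow_le (by norm_num) (by linarith)]
    simpa using hn2
  have hnL : (2 : ℝ) ^ L = n := Real.rpow_logb (by norm_num) (by norm_num) (by linarith)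
  have hsL : s ^ 2 = L := Real.sq_sqrt (by linarith)
  have hs1 : 1 ≤ s := Real.one_le_sqrt.2 hL1
  by_cases htriv : (2 : ℝ) ^ s ≤ 2 * L ^ 3
  · calc (G.copNumber : ℝ) ≤ n := by rw [hnN]; exact_mod_cast copNumber_le_card hG
      _ = n * 2 ^ s * 2 ^ (-s) := by
        rw [mul_assoc, ← Real.rpow_add (by norm_num)]; simp
      _ ≤ n * (2 * L ^ 3) * 2 ^ (-s) := by gcongr
      _ = _ := by ring
  -- There is at least one scale: for `1 ≤ s < 2` the bound is at least `n`, by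
  -- Bernoulli's inequality.
  have hs2 : 2 ≤ s := by
    by_contra! hlt
    apply htriv
    have h1 : (2 : ℝ) ^ (s - 1) ≤ s := by
      have := rpow_one_add_le_one_add_mul_self (s := 1) (p := s - 1) (by norm_num)
        (by linarith) (by linarith)
      norm_num at this
      exact this
    have h2 : (2 : ℝ) ^ s = 2 * 2 ^ (s - 1) := by
      rw [Real.rpow_sub_one (by norm_num)]; ring
    have h3 : s ≤ s ^ 6 := le_self_pow₀ hs1 (by norm_num)
    rw [h2, ← hsL, ← pow_mul]
    norm_num
    linarith
  set q := ⌊s⌋₊ with hq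
  have hq2 : 2 ≤ q := Nat.le_floor (by exact_mod_cast hs2)
  have hqs : (q : ℝ) ≤ s := Nat.floor_le (by linarith)
  have hsq : s < q + 1 := Nat.lt_floor_add_one s
  have hq2' : (2 : ℝ) ≤ q := by exact_mod_cast hq2
  have hqL : (q : ℝ) ^ 2 ≤ L := by rw [← hsL]; gcongr
  set κ : ℝ := 2 ^ q with hκ
  have hκ0 : 0 < κ := by positivity
  have hκn : κ ^ q ≤ n := by
    rw [← hnL, hκ, ← pow_mul, ← Real.rpow_natCast]
    apply Real.rpow_le_rpow_of_exponent_le (by norm_num)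
    push_cast
    nlinarith
  have hκs : (2 : ℝ) ^ s ≤ 2 * κ := by
    calc (2 : ℝ) ^ s ≤ 2 ^ ((q + 1 : ℕ) : ℝ) := by
          apply Real.rpow_le_rpow_of_exponent_le (by norm_num)
          push_cast; exact hsq.le
      _ = 2 * κ := by rw [Real.rpow_natCast, pow_succ, hκ]; ring
  set x := n / κ with hx
  have hx1 : κ ^ (q - 1) ≤ x := by
    rw [hx, le_div_iff₀ hκ0, ← pow_succ, Nat.sub_add_cancel (by omega)]
    exact hκn
  have hx2 : 1 ≤ x := (one_le_pow₀ (one_le_pow₀ (by norm_num))).trans hx1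
  -- The number of cops per scale: it makes `exp (κ m / (2 n)) ≥ exp (L + 2) ≥ 4 n`.
  set m := ⌈2 * x * (L + 2)⌉₊ with hm
  have hm1 : 2 * x * (L + 2) ≤ m := Nat.le_ceil _
  have hm2 : (m : ℝ) < 2 * x * (L + 2) + 1 := Nat.ceil_lt_add_one (by positivity)
  have hexp : 4 * n ≤ Real.exp ((2 ^ q : ℕ) * m / (2 * n)) := by
    have h1 : L + 2 ≤ (2 ^ q : ℕ) * m / (2 * n) := by
      rw [le_div_iff₀ (by linarith)]
      push_cast
      calc (L + 2) * (2 * n) = κ * (2 * x * (L + 2)) := by rw [hx]; field_simp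
        _ ≤ κ * m := by gcongr
    have h2 : (2 : ℝ) ^ (L + 2) = 4 * n := by
      rw [Real.rpow_add (by norm_num), hnL]; norm_num; ring
    rw [← h2, Real.rpow_def_of_pos (by norm_num)]
    apply Real.exp_le_exp.2
    have : Real.log 2 ≤ 1 := by linarith [Real.log_two_lt_d9]
    nlinarith
  have hmain := copNumber_le_of_le_exp hG (T := q - 1) (M := (2 ^ q) ^ (q - 1) + (q - 1) * m)
    (by omega) hexp (by omega) (by omega)
  have hmain' : (G.copNumber : ℝ) ≤ (N / 2 ^ (q - 1 - 1) : ℕ) + 1 +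
      (κ ^ (q - 1) + (q - 1) * m) := by
    have h : (G.copNumber : ℝ) ≤ _ := Nat.cast_le.2 hmain
    push_cast [Nat.cast_sub (by omega : 1 ≤ q)] at h
    exact h
  have hdiv : ((N / 2 ^ (q - 1 - 1) : ℕ) : ℝ) ≤ 4 * x := by
    refine Nat.cast_div_le.trans ?_
    have : κ = 4 * 2 ^ (q - 1 - 1) := by
      rw [hκ, show q = (q - 1 - 1) + 2 by omega, pow_add]
      norm_num; ring
    push_cast
    rw [hx, this, ← hnN]
    exact le_of_eq (by field_simp)
  have hbound : (G.copNumber : ℝ) ≤ x * L ^ 3 := by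
    have hL4 : 4 ≤ L := by nlinarith
    have hqL2 : (q : ℝ) - 1 ≤ L / 2 - 1 := by nlinarith
    have h1 : ((q : ℝ) - 1) * m ≤ (L / 2 - 1) * (2 * x * (L + 2) + x) := by
      gcongr
      · linarith
      · linarith
    have h2 : 6 + (L / 2 - 1) * (2 * L + 5) ≤ L ^ 3 := by nlinarith
    calc (G.copNumber : ℝ) ≤ 4 * x + x + (x + (L / 2 - 1) * (2 * x * (L + 2) + x)) := by linarith
      _ = x * (6 + (L / 2 - 1) * (2 * L + 5)) := by ring
      _ ≤ x * L ^ 3 := by gcongr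
  have hκinv : 1 / κ ≤ 2 * 2 ^ (-s) := by
    rw [Real.rpow_neg (by norm_num), div_le_iff₀ hκ0]
    have : (0 : ℝ) < 2 ^ s := by positivity
    field_simp
    linarith
  calc (G.copNumber : ℝ) ≤ x * L ^ 3 := hbound
    _ = n * L ^ 3 * (1 / κ) := by rw [hx]; ring
    _ ≤ n * L ^ 3 * (2 * 2 ^ (-s)) := by gcongr
    _ = _ := by ring

end SimpleGraph

/-- The correction absorbing the factor `2 (log n) ^ 3` is `-(1 + 3 log log n) / √(log n)`. -/
theorem tendsto_one_add_three_log_log_div_sqrt_log :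
    Tendsto (fun n : ℕ => -(1 + 3 * Real.logb 2 (Real.logb 2 (n : ℝ))) /
      √(Real.logb 2 (n : ℝ))) atTop (𝓝 0) := by
  have hlog : Tendsto (fun n : ℕ => Real.logb 2 (n : ℝ)) atTop atTop :=
    (Real.tendsto_logb_atTop (by norm_num)).comp tendsto_natCast_atTop_atTop
  have h1 : Tendsto (fun x : ℝ => 1 / √x) atTop (𝓝 0) := by
    simp only [one_div]
    exact Real.tendsto_sqrt_atTop.inv_tendsto_atTop
  have h2 : Tendsto (fun x : ℝ => Real.log x / √x) atTop (𝓝 0) := by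
    have := (isLittleO_log_rpow_atTop (r := 1 / 2) (by norm_num)).tendsto_div_nhds_zero
    simpa [Real.sqrt_eq_rpow] using this
  have h3 : Tendsto (fun x : ℝ => -(1 + 3 * Real.logb 2 x) / √x) atTop (𝓝 0) := by
    have := (h1.add (h2.const_mul (3 / Real.log 2))).neg
    simp only [mul_zero, add_zero, neg_zero] at this
    refine this.congr fun x => ?_
    rw [Real.logb]
    ring
  exact h3.comp hlog

theorem theorem1p1 :
    (∃ ε : ℕ → ℝ, Tendsto ε atTop (𝓝 0) ∧
      ∀ (n : ℕ) (V : Type*) [Fintype V] (G : SimpleGraph V),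
        Fintype.card V = n → G.Connected →
          (G.copNumber : ℝ) ≤ (n : ℝ) * (2 : ℝ) ^ (-(1 + ε n) * √(Real.logb 2 (n : ℝ)))) ∧
    (∀ (n : ℕ) (V : Type*) [Fintype V] (G : SimpleGraph V),
      2 ≤ n → Fintype.card V = n → G.Connected →
        (G.copNumber : ℝ) ≤
          2 * (n : ℝ) * Real.logb 2 (n : ℝ) ^ 3 * (2 : ℝ) ^ (-√(Real.logb 2 (n : ℝ)))) := by
  refine ⟨⟨_, tendsto_one_add_three_log_log_div_sqrt_log, ?_⟩, ?_⟩
  · intro n V _ G hV hG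
    subst hV
    rcases lt_or_ge (Fintype.card V) 2 with hlt | hn
    · have h0 : 0 < Fintype.card V := haveI := hG.nonempty; Fintype.card_pos
      have h1 : Fintype.card V = 1 := by omega
      have := SimpleGraph.copNumber_le_card hG
      rw [h1] at this ⊢
      simpa using this
    · refine (SimpleGraph.copNumber_le_two_mul_log_pow hG hn).trans (le_of_eq ?_)
      set n : ℝ := (Fintype.card V : ℝ)
      have hn2 : (2 : ℝ) ≤ n := by simp only [n]; exact_mod_cast hn
      have hL1 : 1 ≤ Real.logb 2 n := by
        rw [Real.le_logb_iff_rpow_le (by norm_num) (by linarith)]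
        simpa using hn2
      set L := Real.logb 2 n
      have hs : √L ≠ 0 := (Real.sqrt_pos.2 (by linarith)).ne'
      have hexp : -(1 + -(1 + 3 * Real.logb 2 L) / √L) * √L =
          1 + Real.logb 2 L * (3 : ℕ) + -√L := by
        field_simp
        push_cast
        ring
      rw [hexp, Real.rpow_add (by norm_num), Real.rpow_add (by norm_num), Real.rpow_mul_natCast
        (by norm_num), Real.rpow_logb (by norm_num) (by norm_num) (by linarith), Real.rpow_one]
      ring
  · intro n V _ G hn hV hG
    subst hV
    exact SimpleGraph.copNumber_le_two_mul_log_pow hG hn
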